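/- Let $(M,g)$ be a connected, smooth, oriented and time-oriented Lorentzian surface (signature $(1,1)$, with $g(e_0,e_0)=-1$ and $g(e_1,e_1)=1$ in local orthonormal frames), with Levi-Civita connection $\nabla$ and a $\mathrm{Spin}(1,1)$-structure, where $\mathrm{Spin}(1,1)$ double covers $SO_0(1,1)$. Let $\mathsf S=\mathbb R^2$ be the real irreducible module of the Clifford algebra with relation $v\cdot v=\eta(v,v)\mathbb 1$, given by $\Gamma_0=\begin{pmatrix}0&1\\-1&0\end{pmatrix}$, $\Gamma_1=\begin{pmatrix}0&1\\1&0\end{pmatrix}$, and let $\mathsf S_\pm$ be the $\pm1$-eigenspaces of $\Gamma_*=\Gamma_0\Gamma_1$. Let $\underline S$ be the associated real rank-2 spinor bundle, with the lift of $\nabla$, also denoted $\nabla$. A spinor field is *chiral at* $p$ if its value at $p$ lies in $(\underline S_+)_p$ or in $(\underline S_-)_p$. Let $B$ be a non-zero admissible bilinear form on $\mathsf S$ of symmetry $\varsigma_B\in\{\pm1\}$: that is, $B(s,s')=\varsigma_B B(s',s)$; there is $\tau_B\in\{\pm1\}$ with $B(s,v\cdot s')=\tau_B B(v\cdot s,s')$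 for all $v$; and $\mathsf S_+$, $\mathsf S_-$ are either mutually $B$-orthogonal or both $B$-isotropic. Let $b\in C^\infty(M)$, let $$\beta(X)\epsilon=\begin{cases} b\,X\cdot\epsilon & \text{if }\varsigma_B=-1,\\ b\,(*X)\cdot\epsilon & \text{if }\varsigma_B=+1,\end{cases}$$ where $*$ is the Hodge star, let $D=\nabla-\beta$, and let $\mathfrak S_D$ be the real vector space of smooth sections $\epsilon$ of $\underline S$ with $D\epsilon=0$ (the Killing spinors). Write $\|db\|^2=g^{-1}(db,db)$, and call $db$ null at $p$ if $\|db\|^2(p)=0$ (this includes $(db)_p=0$). Suppose $\mathfrak S_D\neq 0$. Then $\varsigma_B\|db\|^2\le 0$ everywhere on $M$. Moreover, for every $p\in M$, $db$ is null at $p$ if and only if $p$ is a critical point of $b$ (that is, $(db)_p=0$) or $\mathfrak S_D$ is spanned by a single Killing spinor which is chiral at $p$. -/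

import Mathlib

open scoped Manifold ContDiff Bundle Matrix

noncomputable section

namespace KillingSpinor2D

/-! ### Algebra of signature `(1,1)`: `Γ`-matrices, spin group, admissible bilinears -/

/-- Components of the metric of `ℝ^{1,1}` in an orthonormal basis: `η₀₀ = -1`, `η₁₁ = 1`. -/
def eta (μ ν : Fin 2) : ℝ := if μ = ν then ![-1, 1] μ else 0

/-- The quadratic form `v ↦ η(v,v) = -v₀² + v₁²` of `ℝ^{1,1}`. -/
def quad : QuadraticForm ℝ (Fin 2 → ℝ) := QuadraticMap.weightedSumSquares ℝ ![(-1 : ℝ), 1]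

/-- The pinor module `ℝ²`. -/
abbrev Pinor : Type := Fin 2 → ℝ

/-- The matrices `Γ₀ = iσ₂` and `Γ₁ = σ₁` representing the orthonormal basis. -/
def Gam : Fin 2 → Matrix (Fin 2) (Fin 2) ℝ := ![!![0, 1; -1, 0], !![0, 1; 1, 0]]

/-- `Γ_{μν} = Γ_{[μ}Γ_{ν]}`. -/
def Gam2 (μ ν : Fin 2) : Matrix (Fin 2) (Fin 2) ℝ :=
  (1 / 2 : ℝ) • (Gam μ * Gam ν - Gam ν * Gam μ)

/-- The matrix `Γ_* = Γ₀₁` of the volume element. -/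
def GamStar : Matrix (Fin 2) (Fin 2) ℝ := Gam2 0 1

/-- The matrix `v^μ Γ_μ` of Clifford multiplication by a vector of `ℝ^{1,1}`. -/
def cliff : (Fin 2 → ℝ) →ₗ[ℝ] Matrix (Fin 2) (Fin 2) ℝ where
  toFun v := ∑ μ, v μ • Gam μ
  map_add' v w := by simp [add_smul, Finset.sum_add_distrib]
  map_smul' c v := by simp [mul_smul]

/-- The Clifford relation `v · v = η(v,v) 1`. -/
theorem cliff_mul_self (v : Fin 2 → ℝ) :
    cliff v * cliff v = algebraMap ℝ (Matrix (Fin 2) (Fin 2) ℝ) (quad v) := by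
  ext i j
  fin_cases i <;> fin_cases j <;>
    simp [cliff, quad, Gam, Fin.sum_univ_two, Matrix.mul_apply, Matrix.algebraMap_matrix_apply] <;>
    ring

/-- The pinor representation of the Clifford algebra of `ℝ^{1,1}` on `ℝ²`. -/
def pinRep : CliffordAlgebra quad →ₐ[ℝ] Matrix (Fin 2) (Fin 2) ℝ :=
  CliffordAlgebra.lift quad ⟨cliff, cliff_mul_self⟩

/-- The group `Spin(1,1)` (the double cover of the identity component of `SO(1,1)`), acting on the
pinor module: the image of Mathlib's spin group under the pinor representation. -/
def spin : Submonoid (Matrix (Fin 2) (Fin 2) ℝ) :=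
  (spinGroup quad).map (pinRep : CliffordAlgebra quad →* Matrix (Fin 2) (Fin 2) ℝ)

/-- A pinor is chiral if it lies in one of the half-spin modules `S_±`, the `±1`-eigenspaces
of `Γ_*`. -/
def IsChiral (s : Pinor) : Prop := GamStar *ᵥ s = s ∨ GamStar *ᵥ s = -s

/-- `B` is a (non-zero) admissible bilinear form on the pinor module, of symmetry `ςB`. -/
structure IsAdmissibleBilinear (B : LinearMap.BilinForm ℝ Pinor) (ςB : ℤˣ) : Prop where
  ne_zero : B ≠ 0
  symmetry : ∀ s s', B s s' = ((ςB : ℤ) : ℝ) * B s' s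
  type : ∃ τ : ℤˣ, ∀ (v : Fin 2 → ℝ) (s s' : Pinor),
    B s (cliff v *ᵥ s') = ((τ : ℤ) : ℝ) * B (cliff v *ᵥ s) s'
  isotropy :
    (∀ s s', GamStar *ᵥ s = s → GamStar *ᵥ s' = -s' → B s s' = 0 ∧ B s' s = 0) ∨
    ((∀ s s', GamStar *ᵥ s = s → GamStar *ᵥ s' = s' → B s s' = 0) ∧
      (∀ s s', GamStar *ᵥ s = -s → GamStar *ᵥ s' = -s' → B s s' = 0))

/-- The Hodge star on vectors of `ℝ^{1,1}`, in an oriented orthonormal basis: `*e₀ = -e₁` and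
`*e₁ = -e₀` (that is, `v ∧ *w = η(v,w) e₀ ∧ e₁`, equivalently `*v = -vol · v`). -/
def hodge (v : Fin 2 → ℝ) : Fin 2 → ℝ := ![-v 1, -v 0]

/-! ### Lorentzian surfaces -/

/-- The model space of a surface. -/
abbrev Plane : Type := EuclideanSpace ℝ (Fin 2)

section Geometry

variable {M : Type*} [TopologicalSpace M] [ChartedSpace Plane M] [IsManifold (𝓡 2) ∞ M]

variable (M) in
/-- A smooth Lorentzian metric (mostly plus) on a surface. -/
structure LorentzMetric where
  /-- the scalar product on each tangent space -/
  val (x : M) : TangentSpace (𝓡 2) x →L[ℝ] TangentSpace (𝓡 2) x →L[ℝ] ℝ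
  symm (x : M) (v w : TangentSpace (𝓡 2) x) : val x v w = val x w v
  /-- signature `(1,1)`: every tangent space has an orthonormal basis -/
  signature (x : M) : ∃ e : Module.Basis (Fin 2) ℝ (TangentSpace (𝓡 2) x),
    ∀ μ ν, val x (e μ) (e ν) = eta μ ν
  contMDiff : ContMDiff (𝓡 2) ((𝓡 2).prod 𝓘(ℝ, Plane →L[ℝ] Plane →L[ℝ] ℝ)) ∞
    (fun x ↦ Bundle.TotalSpace.mk' (Plane →L[ℝ] Plane →L[ℝ] ℝ) x (val x))

namespace LorentzMetric

variable (g : LorentzMetric M)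

/-- The metric at a point, as a bilinear form. -/
def bilin (x : M) : LinearMap.BilinForm ℝ (TangentSpace (𝓡 2) x) :=
  LinearMap.mk₂ ℝ (fun v w ↦ g.val x v w) (by simp) (by simp) (by simp) (by simp)

theorem bilin_nondegenerate (x : M) : (g.bilin x).Nondegenerate := by
  obtain ⟨e, he⟩ := g.signature x
  have hl : ∀ v, (∀ w, g.val x v w = 0) → v = 0 := by
    intro v hv
    have h0 := hv (e 0)
    have h1 := hv (e 1)
    have hs := e.sum_repr v
    rw [Fin.sum_univ_two] at hs
    rw [← hs] at h0 h1 ⊢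
    simp only [map_add, map_smul, add_apply, smul_apply, he] at h0 h1
    simp only [eta, smul_eq_mul] at h0 h1
    have h0' : e.repr v 0 = 0 := by simpa using h0
    have h1' : e.repr v 1 = 0 := by simpa using h1
    rw [h0', h1']
    simp
  refine ⟨hl, fun v hv ↦ hl v fun w ↦ ?_⟩
  rw [g.symm]
  exact hv w

/-- The vector `α^♯` metrically dual to a covector `α`. -/
def sharp (x : M) (α : TangentSpace (𝓡 2) x →L[ℝ] ℝ) : TangentSpace (𝓡 2) x :=
  haveI : FiniteDimensional ℝ (TangentSpace (𝓡 2) x) := inferInstanceAs (FiniteDimensional ℝ Plane)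
  (LinearMap.BilinForm.toDual (g.bilin x) (g.bilin_nondegenerate x)).symm α.toLinearMap

/-- The squared norm `‖α‖² = g(α^♯, α^♯)` of a covector. -/
def normSq (x : M) (α : TangentSpace (𝓡 2) x →L[ℝ] ℝ) : ℝ := g.val x (g.sharp x α) (g.sharp x α)

/-- The Levi-Civita connection: torsion-free and compatible with the metric. -/
structure IsLeviCivita
    (cov : CovariantDerivative (𝓡 2) Plane (TangentSpace (𝓡 2) : M → Type _)) : Prop where
  torsion_eq_zero : cov.torsion = 0
  metric : ∀ (Y Z : Π x : M, TangentSpace (𝓡 2) x) (x : M) (v : TangentSpace (𝓡 2) x),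
    MDifferentiableAt (𝓡 2) (𝓡 2).tangent
      (fun y ↦ (Bundle.TotalSpace.mk' Plane y (Y y) : TangentBundle (𝓡 2) M)) x →
    MDifferentiableAt (𝓡 2) (𝓡 2).tangent
      (fun y ↦ (Bundle.TotalSpace.mk' Plane y (Z y) : TangentBundle (𝓡 2) M)) x →
    mvfderiv (𝓡 2) (fun y ↦ g.val y (Y y) (Z y)) x v =
      g.val x (cov Y x v) (Z x) + g.val x (Y x) (cov Z x v)

end LorentzMetric

/-! ### Spin structures, spinor fields and Killing spinors -/

/-- A spin structure on a Lorentzian surface, with structure group the double cover `Spin(1,1)` of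
`SO₀(1,1)`, presented by a trivialising atlas: local orthonormal frames `e_0, e_1` on an open cover
and a smooth `Spin(1,1)`-valued cocycle which lifts the transition functions of the frames. As
`Spin(1,1)` acts on vectors through `SO₀(1,1)`, the frames determine an orientation and a time
orientation. -/
structure SpinStructure (g : LorentzMetric M) (ι : Type*) where
  baseSet : ι → Set M
  isOpen_baseSet : ∀ i, IsOpen (baseSet i)
  indexAt : M → ι
  mem_baseSet_at : ∀ x, x ∈ baseSet (indexAt x)
  /-- the local orthonormal frames -/
  frame : ι → Fin 2 → Π x : M, TangentSpace (𝓡 2) x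
  contMDiffOn_frame : ∀ i μ, ContMDiffOn (𝓡 2) (𝓡 2).tangent ∞
    (fun x ↦ (Bundle.TotalSpace.mk' Plane x (frame i μ x) : TangentBundle (𝓡 2) M)) (baseSet i)
  frame_orthonormal : ∀ i, ∀ x ∈ baseSet i, ∀ μ ν,
    g.val x (frame i μ x) (frame i ν x) = eta μ ν
  /-- the cocycle: `trans i j x` maps components in the spin frame `i` to components in the
  spin frame `j` -/
  trans : ι → ι → M → Matrix (Fin 2) (Fin 2) ℝ
  trans_mem : ∀ i j, ∀ x ∈ baseSet i ∩ baseSet j, trans i j x ∈ spin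
  contMDiffOn_trans : ∀ i j a b, ContMDiffOn (𝓡 2) 𝓘(ℝ, ℝ) ∞ (fun x ↦ trans i j x a b)
    (baseSet i ∩ baseSet j)
  trans_self : ∀ i, ∀ x ∈ baseSet i, trans i i x = 1
  trans_comp : ∀ i j k, ∀ x ∈ baseSet i ∩ baseSet j ∩ baseSet k,
    trans j k x * trans i j x = trans i k x
  /-- the cocycle lifts the change of frames: if `v = v^μ e^i_μ = w^μ e^j_μ` then
  `w^μ Γ_μ = trans (v^μ Γ_μ) trans⁻¹` -/
  lift : ∀ i j, ∀ x ∈ baseSet i ∩ baseSet j, ∀ v w : Fin 2 → ℝ,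
    ∑ μ, v μ • frame i μ x = ∑ μ, w μ • frame j μ x →
    cliff w * trans i j x = trans i j x * cliff v

namespace SpinStructure

variable {g : LorentzMetric M} {ι : Type*} (P : SpinStructure g ι)

/-- A matrix as a continuous linear map of the pinor module. -/
def matCLM : Matrix (Fin 2) (Fin 2) ℝ →ₗ[ℝ] (Pinor →L[ℝ] Pinor) :=
  (LinearMap.toContinuousLinearMap (𝕜 := ℝ) (E := Pinor) (F' := Pinor)).toLinearMap ∘ₗ
    (Matrix.toLin' (R := ℝ) (m := Fin 2) (n := Fin 2)).toLinearMap

@[simp]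
theorem matCLM_apply (A : Matrix (Fin 2) (Fin 2) ℝ) (s : Pinor) : matCLM A s = A *ᵥ s := rfl

theorem contMDiffOn_matCLM (i j : ι) :
    ContMDiffOn (𝓡 2) 𝓘(ℝ, Pinor →L[ℝ] Pinor) ∞ (fun x ↦ matCLM (P.trans i j x))
      (P.baseSet i ∩ P.baseSet j) := by
  have h : ∀ A : Matrix (Fin 2) (Fin 2) ℝ,
      matCLM A = ∑ a, ∑ b, A a b • matCLM (Matrix.single a b 1) := by
    intro A
    conv_lhs => rw [Matrix.matrix_eq_sum_single A]
    simp only [map_sum]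
    refine Finset.sum_congr rfl fun a _ ↦ Finset.sum_congr rfl fun b _ ↦ ?_
    rw [← map_smul, Matrix.smul_single, smul_eq_mul, mul_one]
  rw [funext fun x ↦ h (P.trans i j x)]
  refine contMDiffOn_finsetSum fun a _ ↦ contMDiffOn_finsetSum fun b _ ↦ ?_
  exact (P.contMDiffOn_trans i j a b).smul contMDiffOn_const

/-- The spinor bundle: the rank-two vector bundle associated to the spin structure and the pinor
module. -/
def spinorBundle : VectorBundleCore ℝ M Pinor ι where
  baseSet := P.baseSet
  isOpen_baseSet := P.isOpen_baseSet
  indexAt := P.indexAt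
  mem_baseSet_at := P.mem_baseSet_at
  coordChange i j x := matCLM (P.trans i j x)
  coordChange_self i x hx v := by simp [P.trans_self i x hx]
  continuousOn_coordChange i j := (P.contMDiffOn_matCLM i j).continuousOn
  coordChange_comp i j k x hx v := by
    rw [matCLM_apply, matCLM_apply, matCLM_apply, Matrix.mulVec_mulVec, P.trans_comp i j k x hx]

instance : P.spinorBundle.IsContMDiff (𝓡 2) ∞ := ⟨P.contMDiffOn_matCLM⟩

/-- The space `𝔖` of (smooth) spinor fields: sections of the spinor bundle. -/
abbrev SpinorField : Type _ := ContMDiffSection (𝓡 2) Pinor ∞ P.spinorBundle.Fiber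

/-- The components of a spinor field in the spin frame `i` (meaningful on `P.baseSet i`). -/
def localRep (i : ι) (ψ : P.SpinorField) (x : M) : Pinor :=
  (P.spinorBundle.localTriv i ⟨x, ψ x⟩).2

/-- The components of a tangent vector in the frame `i` (meaningful on `P.baseSet i`). -/
def comp (i : ι) (x : M) (v : TangentSpace (𝓡 2) x) (μ : Fin 2) : ℝ :=
  eta μ μ * g.val x (P.frame i μ x) v

/-- A spinor field is chiral at `p` if its value at `p` lies in one of the half-spin spaces. -/
def IsChiralAt (ψ : P.SpinorField) (p : M) : Prop :=
  IsChiral (P.localRep (P.indexAt p) ψ p)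

/-- The connection coefficients `ω_{μν}(v) = g(e_μ, ∇_v e_ν)` in the frame `i`. -/
def omega (cov : CovariantDerivative (𝓡 2) Plane (TangentSpace (𝓡 2) : M → Type _))
    (i : ι) (μ ν : Fin 2) (x : M) (v : TangentSpace (𝓡 2) x) : ℝ :=
  g.val x (P.frame i μ x) (cov (P.frame i ν) x v)

/-- The lift of `∇` to the spinor bundle, in the spin frame `i`:
`∇_v ψ = dψ(v) + ¼ ω_{μν}(v) Γ^{μν} ψ`. -/
def spinDeriv (cov : CovariantDerivative (𝓡 2) Plane (TangentSpace (𝓡 2) : M → Type _))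
    (i : ι) (ψ : P.SpinorField) (x : M) (v : TangentSpace (𝓡 2) x) : Pinor :=
  mvfderiv (𝓡 2) (P.localRep i ψ) x v +
    ((1 / 4 : ℝ) • ∑ μ, ∑ ν,
      (P.omega cov i μ ν x v * eta μ μ * eta ν ν) • Gam2 μ ν) *ᵥ P.localRep i ψ x

/-- The `End`-valued one-form `β`, in the spin frame `i`: `β(v) = b v ·` if `ςB = -1`, and
`β(v) = b (*v) ·` if `ςB = +1`. -/
def beta (ςB : ℤˣ) (b : M → ℝ) (i : ι) (x : M) (v : TangentSpace (𝓡 2) x) :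
    Matrix (Fin 2) (Fin 2) ℝ :=
  if ςB = -1 then b x • cliff (P.comp i x v) else b x • cliff (hodge (P.comp i x v))

/-- The connection `D = ∇ - β`, in the spin frame `i`. -/
def superDeriv (cov : CovariantDerivative (𝓡 2) Plane (TangentSpace (𝓡 2) : M → Type _))
    (ςB : ℤˣ) (b : M → ℝ) (i : ι) (ψ : P.SpinorField) (x : M) (v : TangentSpace (𝓡 2) x) :
    Pinor :=
  P.spinDeriv cov i ψ x v - P.beta ςB b i x v *ᵥ P.localRep i ψ x

theorem mdifferentiableAt_localRep (i : ι) (ψ : P.SpinorField) {x : M} (hx : x ∈ P.baseSet i) :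
    MDifferentiableAt (𝓡 2) 𝓘(ℝ, Pinor) (P.localRep i ψ) x := by
  have : MemTrivializationAtlas (P.spinorBundle.localTriv i) := ⟨⟨i, rfl⟩⟩
  have h := (Bundle.Trivialization.contMDiffAt_section_iff (IB := 𝓡 2) (n := ∞)
    (P.spinorBundle.localTriv i) (s := ψ) (x₀ := x) hx).1 (ψ.contMDiff_toFun x)
  exact h.mdifferentiableAt (by simp)

theorem localRep_add (i : ι) (ψ φ : P.SpinorField) :
    P.localRep i (ψ + φ) = P.localRep i ψ + P.localRep i φ := by
  funext x
  exact map_add (P.spinorBundle.coordChange (P.spinorBundle.indexAt x) i x) (ψ x) (φ x)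

theorem localRep_smul (i : ι) (c : ℝ) (ψ : P.SpinorField) :
    P.localRep i (c • ψ) = c • P.localRep i ψ := by
  funext x
  exact map_smul (P.spinorBundle.coordChange (P.spinorBundle.indexAt x) i x) c (ψ x)

theorem localRep_zero (i : ι) : P.localRep i (0 : P.SpinorField) = 0 := by
  funext x
  exact map_zero (P.spinorBundle.coordChange (P.spinorBundle.indexAt x) i x)

/-- The space `𝔖_D` of Killing spinors: the spinor fields with `Dε = 0`. -/
def killingSpinors (cov : CovariantDerivative (𝓡 2) Plane (TangentSpace (𝓡 2) : M → Type _))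
    (ςB : ℤˣ) (b : M → ℝ) : Submodule ℝ P.SpinorField where
  carrier := {ε | ∀ i, ∀ x ∈ P.baseSet i, ∀ v : TangentSpace (𝓡 2) x,
    P.superDeriv cov ςB b i ε x v = 0}
  zero_mem' := by
    intro i x hx v
    have h : mvfderiv (𝓡 2) (0 : M → Pinor) x = 0 := by
      exact mvfderiv_const (0 : Pinor)
    simp [superDeriv, spinDeriv, localRep_zero, h]
  add_mem' := by
    intro ψ φ hψ hφ i x hx v
    have h1 := hψ i x hx v
    have h2 := hφ i x hx v
    simp only [superDeriv, spinDeriv] at h1 h2 ⊢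
    rw [localRep_add, mvfderiv_add (P.mdifferentiableAt_localRep i ψ hx)
      (P.mdifferentiableAt_localRep i φ hx)]
    simp only [Pi.add_apply, Matrix.mulVec_add, add_apply]
    linear_combination (exp := 1) h1 + h2
  smul_mem' := by
    intro c ψ hψ i x hx v
    have h1 := hψ i x hx v
    simp only [superDeriv, spinDeriv] at h1 ⊢
    have h2 : mvfderiv (𝓡 2) (c • P.localRep i ψ) x =
        c • mvfderiv (𝓡 2) (P.localRep i ψ) x := by
      have h3 := mvfderiv_smul (I := 𝓡 2) (a := fun _ : M ↦ c) mdifferentiableAt_const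
        (P.mdifferentiableAt_localRep i ψ hx)
      have h4 : mvfderiv (𝓡 2) (fun _ : M ↦ c) x = 0 := mvfderiv_const c
      rw [h4] at h3
      ext1 v
      have h5 := congrArg (fun L ↦ L v) h3
      simpa using! h5
    rw [localRep_smul, h2]
    simp only [Pi.smul_apply, Matrix.mulVec_smul, smul_apply]
    rw [← smul_add, ← smul_sub, h1, smul_zero]

end SpinStructure

end Geometry

end KillingSpinor2D

end

/-!
Let `(u, w)` be the components of a Killing spinor `ε` in a local spin frame over an orthonormal
frame `e₀, e₁`, let `ω` be the connection form, and let `θ⁰, θ¹` be the dual coframe. The Killing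
equation reads (`mvfderiv_localRep_eq`)

  `du = ½ ω u - ςB b (θ⁰ + θ¹) w`,  `dw = -½ ω w + b (θ¹ - θ⁰) u`.

Two consequences carry the proof.

* The connection form drops out of the differential of `f = u w`, which is
  `df = b (-ςB (θ⁰ + θ¹) w² + (θ¹ - θ⁰) u²)`. Evaluating `[e₀, e₁] f = e₀ (e₁ f) - e₁ (e₀ f)` with
  `[e₀, e₁] = -ω(e₀) e₀ + ω(e₁) e₁`, which is the vanishing of the torsion, all terms in `ω` and in
  `b²` cancel and what remains is algebraic in `ε` (`null_components_db_mul_sq`):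
  `(e₀ b + e₁ b) u² = -ςB (e₁ b - e₀ b) w²`.
  This says that the Dirac current of `ε` annihilates `b`.
* The Killing equation is a first order linear system, so a Killing spinor which vanishes at one
  point of the connected surface `M` vanishes identically (`eq_zero_of_localRep_eq_zero`).
  Hence `u` and `w` have no common zero if `ε ≠ 0`.

As `‖db‖² = (e₁ b - e₀ b) (e₁ b + e₀ b)` (`normSq_eq`), multiplying the relation by either factor
gives the sign of `ςB ‖db‖²`. If `db ≠ 0` is null at `p`, exactly one of the two factors vanishes,
so the relation forces the same chiral component of *every* Killing spinor to vanish at `p`; the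
values of Killing spinors at `p` then lie on a line, and evaluation at `p` is injective
(`killingSpinors_eq_span`). Conversely, if `ε ≠ 0` is chiral at `p`, the relation makes one of the
factors vanish.
-/

namespace KillingSpinor2D

open VectorField Filter Topology

/-! ### Calculus on manifolds: commutators, and linear differential inequalities -/

theorem mvfderiv_congr {E H M F : Type*} [NormedAddCommGroup E]
    [NormedSpace ℝ E] [TopologicalSpace H] {I : ModelWithCorners ℝ E H}
    [TopologicalSpace M] [ChartedSpace H M] [NormedAddCommGroup F] [NormedSpace ℝ F]
    {f f' : M → F} {x : M} (h : f =ᶠ[nhds x] f') : mvfderiv I f x = mvfderiv I f' x := by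
  ext v
  exact congrArg (fun L ↦ (L v : F)) (h.mfderiv_eq (I := I) (I' := 𝓘(ℝ, F)))

/-- The Lie bracket acts on functions as the commutator of derivations. The auxiliary field `Z`,
nonvanishing at `x`, lets the identity be read off from the Jacobi identity for `X`, `Y`, `f • Z` by
expanding with the Leibniz rule. -/
theorem mvfderiv_mlieBracket_apply {E H M : Type*} [NormedAddCommGroup E]
    [NormedSpace ℝ E] [CompleteSpace E] [TopologicalSpace H] {I : ModelWithCorners ℝ E H}
    [TopologicalSpace M] [ChartedSpace H M] [IsManifold I ∞ M]
    {X Y Z : Π x : M, TangentSpace I x} {f : M → ℝ} {x : M}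
    (hX : CMDiffAt ∞ (T% X) x) (hY : CMDiffAt ∞ (T% Y) x) (hZ : CMDiffAt ∞ (T% Z) x)
    (hZx : Z x ≠ 0) (hf : CMDiffAt ∞ f x)
    (hXf : MDiffAt (fun y ↦ mvfderiv I f y (X y)) x)
    (hYf : MDiffAt (fun y ↦ mvfderiv I f y (Y y)) x) :
    mvfderiv I f x (mlieBracket I X Y x) =
      mvfderiv I (fun y ↦ mvfderiv I f y (Y y)) x (X x) -
        mvfderiv I (fun y ↦ mvfderiv I f y (X y)) x (Y x) := by
  have hmd {V : Π x : M, TangentSpace I x} (hV : CMDiffAt ∞ (T% V) x) : MDiffAt (T% V) x :=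
    hV.mdifferentiableAt (by simp)
  have hfd : MDiffAt f x := hf.mdifferentiableAt (by simp)
  have hmin : minSmoothness ℝ 2 ≤ (∞ : WithTop ℕ∞) := by
    rw [minSmoothness_of_isRCLikeNormedField]; exact WithTop.coe_le_coe.2 le_top
  have hM : ∀ k : ℕ, IsManifold I (minSmoothness ℝ k) M := fun k ↦ by
    rw [minSmoothness_of_isRCLikeNormedField]
    exact IsManifold.of_le (n := ∞) (WithTop.coe_le_coe.2 le_top)
  have := hM 2
  have := hM 3
  have hbr {U V : Π x : M, TangentSpace I x} (hU : CMDiffAt ∞ (T% U) x)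
      (hV : CMDiffAt ∞ (T% V) x) : CMDiffAt ∞ (T% (mlieBracket I U V)) x :=
    haveI : IsManifold I ((⊤ : ℕ∞) + 1) M := inferInstanceAs (IsManifold I ∞ M)
    ContMDiffAt.mlieBracket_vectorField (n := ⊤) (m := ⊤) hU hV (by simp)
  have hfZ : CMDiffAt ∞ (T% (f • Z)) x := hf.smul_section hZ
  have key {U V : Π x : M, TangentSpace I x} (hU : CMDiffAt ∞ (T% U) x)
      (hV : CMDiffAt ∞ (T% V) x) (hVf : MDiffAt (fun y ↦ mvfderiv I f y (V y)) x) :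
      mlieBracket I U (mlieBracket I V (f • Z)) x =
        (mvfderiv I (fun y ↦ mvfderiv I f y (V y)) x (U x) • Z x +
          mvfderiv I f x (V x) • mlieBracket I U Z x) +
        (mvfderiv I f x (U x) • mlieBracket I V Z x +
          f x • mlieBracket I U (mlieBracket I V Z) x) := by
    have hfe : ∀ᶠ y in 𝓝 x, MDiffAt f y := by
      filter_upwards [(contMDiffAt_iff_contMDiffAt_nhds (n := 1) (by simp)).1
        (hf.of_le (by simp))] with y hy
      exact hy.mdifferentiableAt (by simp)
    have hZe : ∀ᶠ y in 𝓝 x, MDiffAt (T% Z) y := by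
      filter_upwards [(contMDiffAt_iff_contMDiffAt_nhds (n := 1) (by simp)).1
        (hZ.of_le (by simp))] with y hy
      exact hy.mdifferentiableAt (by simp)
    have he : mlieBracket I V (f • Z) =ᶠ[𝓝 x]
        (fun y ↦ mvfderiv I f y (V y)) • Z + f • mlieBracket I V Z := by
      filter_upwards [hfe, hZe] with y hy hy'
      exact mlieBracket_smul_right hy hy'
    rw [(EventuallyEq.refl _ U).mlieBracket_vectorField_eq he, mlieBracket_add_right,
      mlieBracket_smul_right hVf (hmd hZ), mlieBracket_smul_right hfd (hmd (hbr hV hZ))]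
    · exact hVf.smul_section (hmd hZ)
    · exact hfd.smul_section (hmd (hbr hV hZ))
  have h1 := leibniz_identity_mlieBracket_apply (hX.of_le hmin) (hY.of_le hmin) (hfZ.of_le hmin)
  have h2 := leibniz_identity_mlieBracket_apply (hX.of_le hmin) (hY.of_le hmin) (hZ.of_le hmin)
  rw [key hX hY hYf, key hY hX hXf, mlieBracket_smul_right hfd (hmd hZ), h2] at h1
  rw [← sub_eq_zero]
  refine (smul_eq_zero.1 (?_ : _ • Z x = 0)).resolve_right hZx
  rw [← sub_eq_zero] at h1
  rw [← neg_eq_zero, ← h1]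
  module

/-- A differentiable map with `‖f'‖ ≤ K ‖f‖` which vanishes at a point vanishes nearby: Grönwall's
inequality along segments issuing from that point. -/
theorem eventually_eq_zero_of_norm_fderiv_le {E F : Type*} [NormedAddCommGroup E]
    [NormedSpace ℝ E] [NormedAddCommGroup F] [NormedSpace ℝ F] {f : E → F} {a : E} {K : ℝ}
    (hd : ∀ᶠ y in 𝓝 a, DifferentiableAt ℝ f y) (hK : ∀ᶠ y in 𝓝 a, ‖fderiv ℝ f y‖ ≤ K * ‖f y‖)
    (ha : f a = 0) : ∀ᶠ y in 𝓝 a, f y = 0 := by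
  obtain ⟨r, hr, hball⟩ := Metric.eventually_nhds_iff_ball.1 (hd.and hK)
  filter_upwards [Metric.ball_mem_nhds a hr] with y hy
  have hseg : ∀ t ∈ Set.Icc (0 : ℝ) 1, a + t • (y - a) ∈ Metric.ball a r := by
    intro t ht
    rw [mem_ball_iff_norm, add_sub_cancel_left, norm_smul, Real.norm_of_nonneg ht.1]
    rw [mem_ball_iff_norm] at hy
    exact (mul_le_of_le_one_left (norm_nonneg _) ht.2).trans_lt hy
  have hder : ∀ t ∈ Set.Icc (0 : ℝ) 1, HasDerivAt (fun t : ℝ ↦ f (a + t • (y - a)))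
      (fderiv ℝ f (a + t • (y - a)) (y - a)) t := by
    intro t ht
    have h1 : HasDerivAt (fun t : ℝ ↦ a + t • (y - a)) (y - a) t := by
      simpa using ((hasDerivAt_id t).smul_const (y - a)).const_add a
    exact (hball _ (hseg t ht)).1.hasFDerivAt.comp_hasDerivAt t h1
  have := eq_zero_of_abs_deriv_le_mul_abs_self_of_eq_zero_right (K := K * ‖y - a‖)
    (fun t ht ↦ (hder t ht).continuousAt.continuousWithinAt)
    (fun t ht ↦ (hder t (Set.Ico_subset_Icc_self ht)).hasDerivWithinAt) (by simpa using ha)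
    (fun t ht ↦ ?_) 1 (by simp)
  · simpa using this
  · have := (hball _ (hseg t (Set.Ico_subset_Icc_self ht))).2
    calc _ ≤ _ := ContinuousLinearMap.le_opNorm _ _
      _ ≤ _ := mul_le_mul_of_nonneg_right this (norm_nonneg _)
      _ = _ := by ring

theorem exists_bound_nhds {X : Type*} [TopologicalSpace X] {f : X → ℝ} {x : X}
    (h : ContinuousAt f x) : ∃ K, ∀ᶠ y in nhds x, |f y| ≤ K :=
  ⟨|f x| + 1, (h.abs.eventually_lt continuousAt_const (by simp)).mono fun _ hy ↦ hy.le⟩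

/-! ### The algebra of the pinor module in components -/

theorem GamStar_eq : GamStar = !![1, 0; 0, -1] := by
  ext i j
  fin_cases i <;> fin_cases j <;> norm_num [GamStar, Gam2, Gam, Matrix.mul_apply, Fin.sum_univ_two]

/-- In the chosen basis of the pinor module `S₊` and `S₋` are the coordinate axes. -/
theorem isChiral_iff (s : Pinor) : IsChiral s ↔ s 0 = 0 ∨ s 1 = 0 := by
  have h : GamStar *ᵥ s = ![s 0, -s 1] := by
    ext i
    fin_cases i <;> simp [GamStar_eq, Matrix.mulVec, dotProduct]
  rw [IsChiral, h]
  constructor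
  · rintro (h | h)
    · right; have := congrFun h 1; simp at this; linarith
    · left; have := congrFun h 0; simp at this; linarith
  · rintro (h | h)
    · right; ext i; fin_cases i <;> simp [h]
    · left; ext i; fin_cases i <;> simp [h]

theorem cliff_eq (v : Fin 2 → ℝ) : cliff v = !![0, v 0 + v 1; v 1 - v 0, 0] := by
  ext i j
  fin_cases i <;> fin_cases j <;> simp [cliff, Gam, Fin.sum_univ_two]
  ring

variable {M : Type*} [TopologicalSpace M] [ChartedSpace Plane M] [IsManifold (𝓡 2) ∞ M]

namespace SpinStructure

/-! ### Orthonormal frames and the connection form -/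

variable {g : LorentzMetric M} {ι : Type*} (P : SpinStructure g ι)

theorem contMDiffAt_frame {i : ι} {x : M} (hx : x ∈ P.baseSet i) (μ : Fin 2) :
    ContMDiffAt (𝓡 2) (𝓡 2).tangent ∞
      (fun y ↦ (Bundle.TotalSpace.mk' Plane y (P.frame i μ y) : TangentBundle (𝓡 2) M)) x :=
  (P.contMDiffOn_frame i μ).contMDiffAt ((P.isOpen_baseSet i).mem_nhds hx)

theorem mdifferentiableAt_frame {i : ι} {x : M} (hx : x ∈ P.baseSet i) (μ : Fin 2) :
    MDifferentiableAt (𝓡 2) (𝓡 2).tangent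
      (fun y ↦ (Bundle.TotalSpace.mk' Plane y (P.frame i μ y) : TangentBundle (𝓡 2) M)) x :=
  (P.contMDiffAt_frame hx μ).mdifferentiableAt (by simp)

theorem comp_frame {i : ι} {x : M} (hx : x ∈ P.baseSet i) (μ ν : Fin 2) :
    P.comp i x (P.frame i ν x) μ = if μ = ν then 1 else 0 := by
  rw [comp, P.frame_orthonormal i x hx]
  fin_cases μ <;> fin_cases ν <;> simp [eta]

theorem linearIndependent_frame {i : ι} {x : M} (hx : x ∈ P.baseSet i) :
    LinearIndependent ℝ (fun μ ↦ P.frame i μ x) := by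
  rw [Fintype.linearIndependent_iff]
  intro c hc μ
  have h := congrArg (fun v ↦ P.comp i x v μ) hc
  simp only [comp, Fin.sum_univ_two, map_add, map_smul, map_zero, smul_eq_mul,
    P.frame_orthonormal i x hx] at h
  fin_cases μ <;> simpa [eta] using h

theorem sum_comp_smul_frame {i : ι} {x : M} (hx : x ∈ P.baseSet i) (v : TangentSpace (𝓡 2) x) :
    ∑ μ, P.comp i x v μ • P.frame i μ x = v := by
  have hfr : Module.finrank ℝ (TangentSpace (𝓡 2) x) = 2 := by
    change Module.finrank ℝ Plane = 2
    simp
  let e := basisOfLinearIndependentOfCardEqFinrank (P.linearIndependent_frame hx)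
    (by simp [hfr])
  have he : ∀ μ, e μ = P.frame i μ x := fun μ ↦ by simp [e]
  conv_rhs => rw [← e.sum_repr v]
  refine Finset.sum_congr rfl fun μ _ ↦ ?_
  rw [he]
  congr 1
  conv_lhs => rw [← e.sum_repr v]
  simp only [comp, Fin.sum_univ_two, map_add, map_smul, smul_eq_mul, he,
    P.frame_orthonormal i x hx]
  fin_cases μ <;> simp [eta]

theorem normSq_eq {i : ι} {x : M} (hx : x ∈ P.baseSet i) (α : TangentSpace (𝓡 2) x →L[ℝ] ℝ) :
    g.normSq x α = -(α (P.frame i 0 x)) ^ 2 + (α (P.frame i 1 x)) ^ 2 := by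
  have : FiniteDimensional ℝ (TangentSpace (𝓡 2) x) := inferInstanceAs (FiniteDimensional ℝ Plane)
  have hα : ∀ w, g.val x (g.sharp x α) w = α w := fun w ↦
    LinearMap.BilinForm.apply_toDual_symm_apply (hB := g.bilin_nondegenerate x) α.toLinearMap w
  rw [LorentzMetric.normSq, hα]
  conv_lhs => rw [← P.sum_comp_smul_frame hx (g.sharp x α)]
  simp only [Fin.sum_univ_two, comp, map_add, map_smul, smul_eq_mul]
  rw [g.symm, hα, g.symm, hα]
  simp [eta]
  ring

variable {cov : CovariantDerivative (𝓡 2) Plane (TangentSpace (𝓡 2) : M → Type _)}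

/-- Metric compatibility: `g(e_μ, e_ν)` is locally constant, so `ω` is antisymmetric. -/
theorem omega_swap (hcov : g.IsLeviCivita cov) {i : ι} {x : M} (hx : x ∈ P.baseSet i)
    (v : TangentSpace (𝓡 2) x) (μ ν : Fin 2) :
    P.omega cov i μ ν x v = -P.omega cov i ν μ x v := by
  have h := hcov.metric (P.frame i μ) (P.frame i ν) x v (P.mdifferentiableAt_frame hx μ)
    (P.mdifferentiableAt_frame hx ν)
  have h0 : mvfderiv (𝓡 2) (fun y ↦ g.val y (P.frame i μ y) (P.frame i ν y)) x = 0 := by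
    have he : (fun y ↦ g.val y (P.frame i μ y) (P.frame i ν y)) =ᶠ[nhds x] fun _ ↦ eta μ ν := by
      filter_upwards [(P.isOpen_baseSet i).mem_nhds hx] with y hy
      exact P.frame_orthonormal i y hy μ ν
    rw [mvfderiv_congr he]
    exact mvfderiv_const _
  rw [h0, g.symm] at h
  simp only [omega]
  simp at h
  linarith

/-- Vanishing torsion, in an orthonormal frame: the connection form is determined by `[e₀, e₁]`. -/
theorem mlieBracket_frame (hcov : g.IsLeviCivita cov) {i : ι} {x : M} (hx : x ∈ P.baseSet i) :
    mlieBracket (𝓡 2) (P.frame i 0) (P.frame i 1) x =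
      -P.omega cov i 0 1 x (P.frame i 0 x) • P.frame i 0 x +
        P.omega cov i 0 1 x (P.frame i 1 x) • P.frame i 1 x := by
  have h := (cov.torsion_eq_zero_iff).1 hcov.torsion_eq_zero (P.mdifferentiableAt_frame hx 0)
    (P.mdifferentiableAt_frame hx 1)
  have h00 := P.omega_swap hcov hx (P.frame i 1 x) 0 0
  have h11 := P.omega_swap hcov hx (P.frame i 0 x) 1 1
  have h10 := P.omega_swap hcov hx (P.frame i 1 x) 1 0
  rw [← P.sum_comp_smul_frame hx (mlieBracket _ _ _ _), ← h, Fin.sum_univ_two]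
  simp only [omega, comp, map_sub] at *
  congr 2
  · simp [eta]; linarith
  · simp [eta]; linarith

theorem contMDiffAt_metric {X Y : Π x : M, TangentSpace (𝓡 2) x} {x : M}
    (hX : ContMDiffAt (𝓡 2) (𝓡 2).tangent ∞
      (fun y ↦ (Bundle.TotalSpace.mk' Plane y (X y) : TangentBundle (𝓡 2) M)) x)
    (hY : ContMDiffAt (𝓡 2) (𝓡 2).tangent ∞
      (fun y ↦ (Bundle.TotalSpace.mk' Plane y (Y y) : TangentBundle (𝓡 2) M)) x) :
    ContMDiffAt (𝓡 2) 𝓘(ℝ, ℝ) ∞ (fun y ↦ g.val y (X y) (Y y)) x := by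
  have : ContMDiffAt (𝓡 2) ((𝓡 2).prod 𝓘(ℝ, ℝ)) ∞
      (fun m ↦ Bundle.TotalSpace.mk' ℝ (E := Bundle.Trivial M ℝ) m (g.val m (X m) (Y m))) x := by
    apply ContMDiffAt.clm_bundle_apply₂ (F₁ := Plane) (F₂ := Plane)
    · exact g.contMDiff.contMDiffAt
    · exact hX
    · exact hY
  rw [Bundle.contMDiffAt_totalSpace] at this
  exact this.2

theorem continuousAt_comp {X : Π x : M, TangentSpace (𝓡 2) x} {i : ι} {x : M}
    (hx : x ∈ P.baseSet i)
    (hX : ContMDiffAt (𝓡 2) (𝓡 2).tangent ∞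
      (fun y ↦ (Bundle.TotalSpace.mk' Plane y (X y) : TangentBundle (𝓡 2) M)) x) (μ : Fin 2) :
    ContinuousAt (fun y ↦ P.comp i y (X y) μ) x :=
  continuousAt_const.mul (contMDiffAt_metric (P.contMDiffAt_frame hx μ) hX).continuousAt

/-- The covariant derivative is not assumed to depend continuously on the base point; continuity of
`ω` is recovered from its expression through the bracket `[e₀, e₁]` of smooth fields. -/
theorem continuousAt_omega (hcov : g.IsLeviCivita cov) {X : Π x : M, TangentSpace (𝓡 2) x} {i : ι}
    {x : M} (hx : x ∈ P.baseSet i)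
    (hX : ContMDiffAt (𝓡 2) (𝓡 2).tangent ∞
      (fun y ↦ (Bundle.TotalSpace.mk' Plane y (X y) : TangentBundle (𝓡 2) M)) x) :
    ContinuousAt (fun y ↦ P.omega cov i 0 1 y (X y)) x := by
  have : IsManifold (𝓡 2) ((⊤ : ℕ∞) + 1) M := inferInstanceAs (IsManifold (𝓡 2) ∞ M)
  have : IsManifold (𝓡 2) (minSmoothness ℝ 2) M := by
    rw [minSmoothness_of_isRCLikeNormedField]
    exact IsManifold.of_le (n := ∞) (WithTop.coe_le_coe.2 le_top)
  have hbr := ContMDiffAt.mlieBracket_vectorField (n := ⊤) (m := ⊤)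
    (P.contMDiffAt_frame hx 0) (P.contMDiffAt_frame hx 1) (by simp)
  have h := ((P.continuousAt_comp hx hX 0).mul (P.continuousAt_comp hx hbr 0).neg).add
    ((P.continuousAt_comp hx hX 1).mul (P.continuousAt_comp hx hbr 1))
  refine h.congr ?_
  filter_upwards [(P.isOpen_baseSet i).mem_nhds hx] with y hy
  have hc : ∀ (a b : ℝ) (μ : Fin 2), P.comp i y (a • P.frame i 0 y + b • P.frame i 1 y) μ =
      ![a, b] μ := by
    intro a b μ
    have h0 := P.comp_frame hy μ 0
    have h1 := P.comp_frame hy μ 1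
    simp only [comp] at h0 h1 ⊢
    rw [map_add, map_smul, map_smul, smul_eq_mul, smul_eq_mul, mul_add, mul_left_comm, h0,
      mul_left_comm, h1]
    fin_cases μ <;> simp
  have hω : P.omega cov i 0 1 y (X y) = P.comp i y (X y) 0 * P.omega cov i 0 1 y (P.frame i 0 y) +
      P.comp i y (X y) 1 * P.omega cov i 0 1 y (P.frame i 1 y) := by
    conv_lhs => rw [← P.sum_comp_smul_frame hy (X y)]
    simp [omega, Fin.sum_univ_two]
  simp only [Pi.add_apply, Pi.mul_apply, Pi.neg_apply]
  rw [hω, P.mlieBracket_frame hcov hy, hc, hc]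
  simp

/-! ### The Killing equation in a spin frame -/

/-- The Killing equation, written out in a spin frame. -/
theorem mvfderiv_localRep_eq (hcov : g.IsLeviCivita cov) {ςB : ℤˣ} {b : M → ℝ}
    {ε : P.SpinorField} (hε : ε ∈ P.killingSpinors cov ςB b) {i : ι} {x : M}
    (hx : x ∈ P.baseSet i) (v : TangentSpace (𝓡 2) x) :
    mvfderiv (𝓡 2) (P.localRep i ε) x v =
      ![1 / 2 * P.omega cov i 0 1 x v * P.localRep i ε x 0 -
          ((ςB : ℤ) : ℝ) * b x * (P.comp i x v 0 + P.comp i x v 1) * P.localRep i ε x 1,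
        -(1 / 2) * P.omega cov i 0 1 x v * P.localRep i ε x 1 +
          b x * (P.comp i x v 1 - P.comp i x v 0) * P.localRep i ε x 0] := by
  have h := hε i x hx v
  have h10 := P.omega_swap hcov hx v 1 0
  have hG : ∀ μ, Gam2 μ μ = 0 := fun μ ↦ by simp [Gam2]
  have hG1 : Gam2 1 0 = -GamStar := by
    rw [GamStar, Gam2, Gam2, ← smul_neg, neg_sub]
  have hG0 : Gam2 0 1 = GamStar := rfl
  simp only [superDeriv, spinDeriv, Fin.sum_univ_two, hG, hG1, hG0, h10, beta, cliff_eq] at h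
  rw [sub_eq_zero, ← eq_sub_iff_add_eq] at h
  rw [h]
  ext a
  obtain rfl | rfl := Int.units_eq_one_or ςB <;> fin_cases a <;>
    simp [GamStar_eq, eta, hodge, dotProduct, Fin.sum_univ_two] <;> ring

theorem contMDiffAt_localRep {i : ι} (ε : P.SpinorField) {x : M} (hx : x ∈ P.baseSet i) :
    ContMDiffAt (𝓡 2) 𝓘(ℝ, Pinor) ∞ (P.localRep i ε) x := by
  have : MemTrivializationAtlas (P.spinorBundle.localTriv i) := ⟨⟨i, rfl⟩⟩
  exact (Bundle.Trivialization.contMDiffAt_section_iff (IB := 𝓡 2) (n := ∞)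
    (P.spinorBundle.localTriv i) (s := ε) (x₀ := x) hx).1 (ε.contMDiff_toFun x)

theorem contMDiffAt_localRep_apply {i : ι} (ε : P.SpinorField) {x : M} (hx : x ∈ P.baseSet i)
    (a : Fin 2) : ContMDiffAt (𝓡 2) 𝓘(ℝ, ℝ) ∞ (fun y ↦ P.localRep i ε y a) x :=
  (ContinuousLinearMap.proj (R := ℝ) (φ := fun _ : Fin 2 ↦ ℝ) a).contMDiff.contMDiffAt.comp x
    (P.contMDiffAt_localRep ε hx)

theorem mvfderiv_localRep_apply {i : ι} (ε : P.SpinorField) {x : M} (hx : x ∈ P.baseSet i)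
    (a : Fin 2) (v : TangentSpace (𝓡 2) x) :
    mvfderiv (𝓡 2) (fun y ↦ P.localRep i ε y a) x v = mvfderiv (𝓡 2) (P.localRep i ε) x v a := by
  have h := (((ContinuousLinearMap.proj (R := ℝ)
    (φ := fun _ : Fin 2 ↦ ℝ) a).hasMFDerivAt (x := P.localRep i ε x)).comp x
    (P.mdifferentiableAt_localRep i ε hx).hasMFDerivAt).mfderiv
  exact congrArg (fun L ↦ (L v : ℝ)) h

/-- The identity `[e₀, e₁] f = e₀ (e₁ f) - e₁ (e₀ f)` for the product `f` of the two components of a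
Killing spinor: its Dirac current annihilates `b`. -/
theorem null_components_db_mul_sq (hcov : g.IsLeviCivita cov) {ςB : ℤˣ} {b : M → ℝ}
    (hb : ContMDiff (𝓡 2) 𝓘(ℝ, ℝ) ∞ b)
    {ε : P.SpinorField} (hε : ε ∈ P.killingSpinors cov ςB b) {i : ι} {x : M}
    (hx : x ∈ P.baseSet i) :
    (mvfderiv (𝓡 2) b x (P.frame i 0 x) + mvfderiv (𝓡 2) b x (P.frame i 1 x)) *
        P.localRep i ε x 0 ^ 2 =
      -((ςB : ℤ) : ℝ) *
        (mvfderiv (𝓡 2) b x (P.frame i 1 x) - mvfderiv (𝓡 2) b x (P.frame i 0 x)) *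
        P.localRep i ε x 1 ^ 2 := by
  set u : M → ℝ := fun y ↦ P.localRep i ε y 0 with hu
  set w : M → ℝ := fun y ↦ P.localRep i ε y 1 with hw
  set s : ℝ := -((ςB : ℤ) : ℝ) with hs
  have hud : ∀ y ∈ P.baseSet i, MDifferentiableAt (𝓡 2) 𝓘(ℝ, ℝ) u y := fun y hy ↦
    (P.contMDiffAt_localRep_apply ε hy 0).mdifferentiableAt (by simp)
  have hwd : ∀ y ∈ P.baseSet i, MDifferentiableAt (𝓡 2) 𝓘(ℝ, ℝ) w y := fun y hy ↦
    (P.contMDiffAt_localRep_apply ε hy 1).mdifferentiableAt (by simp)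
  have hbd : MDifferentiableAt (𝓡 2) 𝓘(ℝ, ℝ) b x := (hb x).mdifferentiableAt (by simp)
  have hdu : ∀ y ∈ P.baseSet i, ∀ v, mvfderiv (𝓡 2) u y v =
      1 / 2 * P.omega cov i 0 1 y v * u y + s * b y * (P.comp i y v 0 + P.comp i y v 1) * w y := by
    intro y hy v
    rw [hu, P.mvfderiv_localRep_apply ε hy, P.mvfderiv_localRep_eq hcov hε hy]
    simp only [Matrix.cons_val_zero, hs, hw]
    ring
  have hdw : ∀ y ∈ P.baseSet i, ∀ v, mvfderiv (𝓡 2) w y v =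
      -(1 / 2) * P.omega cov i 0 1 y v * w y + b y * (P.comp i y v 1 - P.comp i y v 0) * u y := by
    intro y hy v
    rw [hw, P.mvfderiv_localRep_apply ε hy, P.mvfderiv_localRep_eq hcov hε hy]
    simp only [Matrix.cons_val_one, Matrix.cons_val_zero, hu]
  -- The connection form drops out of the differential of `u * w`.
  have hdf : ∀ y ∈ P.baseSet i, ∀ v, mvfderiv (𝓡 2) (u * w) y v =
      b y * (s * (P.comp i y v 0 + P.comp i y v 1) * (w y * w y) +
        (P.comp i y v 1 - P.comp i y v 0) * (u y * u y)) := by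
    intro y hy v
    rw [mvfderiv_mul (hud y hy) (hwd y hy)]
    simp only [add_apply, smul_apply, smul_eq_mul, hdu y hy, hdw y hy]
    ring
  have hnhds := (P.isOpen_baseSet i).mem_nhds hx
  have he0 : (fun y ↦ mvfderiv (𝓡 2) (u * w) y (P.frame i 0 y)) =ᶠ[nhds x]
      b * ((fun _ ↦ s) * (w * w) - u * u) := by
    filter_upwards [hnhds] with y hy
    rw [hdf y hy]
    simp only [P.comp_frame hy, Pi.mul_apply, Pi.sub_apply]
    simp only [Fin.reduceEq, if_true, if_false]
    ring
  have he1 : (fun y ↦ mvfderiv (𝓡 2) (u * w) y (P.frame i 1 y)) =ᶠ[nhds x]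
      b * ((fun _ ↦ s) * (w * w) + u * u) := by
    filter_upwards [hnhds] with y hy
    rw [hdf y hy]
    simp only [P.comp_frame hy, Pi.mul_apply, Pi.add_apply]
    simp only [Fin.reduceEq, if_true, if_false]
    ring
  have hud := hud x hx
  have hwd := hwd x hx
  have hsd : MDifferentiableAt (𝓡 2) 𝓘(ℝ, ℝ) (fun _ : M ↦ s) x := mdifferentiableAt_const
  have hne : P.frame i 0 x ≠ 0 := (P.linearIndependent_frame hx).ne_zero 0
  have key := mvfderiv_mlieBracket_apply (f := u * w) (P.contMDiffAt_frame hx 0)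
    (P.contMDiffAt_frame hx 1) (P.contMDiffAt_frame hx 0) hne
    ((P.contMDiffAt_localRep_apply ε hx 0).mul (P.contMDiffAt_localRep_apply ε hx 1))
    ((hbd.mul ((hsd.mul (hwd.mul hwd)).sub (hud.mul hud))).congr_of_eventuallyEq he0)
    ((hbd.mul ((hsd.mul (hwd.mul hwd)).add (hud.mul hud))).congr_of_eventuallyEq he1)
  have hds : mvfderiv (𝓡 2) (fun _ : M ↦ s) x = 0 := mvfderiv_const s
  rw [mvfderiv_congr he0, mvfderiv_congr he1, P.mlieBracket_frame hcov hx, map_add, map_smul,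
    map_smul, hdf x hx, hdf x hx,
    mvfderiv_mul hbd ((hsd.mul (hwd.mul hwd)).sub (hud.mul hud)),
    mvfderiv_mul hbd ((hsd.mul (hwd.mul hwd)).add (hud.mul hud)),
    mvfderiv_sub (hsd.mul (hwd.mul hwd)) (hud.mul hud),
    mvfderiv_add (hsd.mul (hwd.mul hwd)) (hud.mul hud), mvfderiv_mul hsd (hwd.mul hwd),
    mvfderiv_mul hwd hwd, mvfderiv_mul hud hud, hds] at key
  simp only [add_apply, sub_apply, smul_apply, smul_eq_mul, hdu x hx, hdw x hx,
    P.comp_frame hx, Pi.mul_apply, Pi.add_apply, Pi.sub_apply, zero_apply,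
    Fin.reduceEq, if_true, if_false] at key
  change (_ + _) * u x ^ 2 = s * (_ - _) * w x ^ 2
  linear_combination -key

/-! ### Unique continuation for Killing spinors -/

theorem exists_norm_mvfderiv_localRep_le (hcov : g.IsLeviCivita cov) {ςB : ℤˣ} {b : M → ℝ}
    (hb : ContMDiff (𝓡 2) 𝓘(ℝ, ℝ) ∞ b)
    {ε : P.SpinorField} (hε : ε ∈ P.killingSpinors cov ςB b) {i : ι} {x : M}
    (hx : x ∈ P.baseSet i) {X : Π x : M, TangentSpace (𝓡 2) x}
    (hX : ContMDiffAt (𝓡 2) (𝓡 2).tangent ∞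
      (fun y ↦ (Bundle.TotalSpace.mk' Plane y (X y) : TangentBundle (𝓡 2) M)) x) :
    ∃ K, 0 ≤ K ∧ ∀ᶠ y in 𝓝 x,
      ‖mvfderiv (𝓡 2) (P.localRep i ε) y (X y)‖ ≤ K * ‖P.localRep i ε y‖ := by
  have hω := P.continuousAt_omega hcov hx hX
  have h0 := P.continuousAt_comp hx hX 0
  have h1 := P.continuousAt_comp hx hX 1
  have hb' : ContinuousAt b x := (hb x).continuousAt
  obtain ⟨K, hK⟩ := exists_bound_nhds
    (f := fun y ↦ |1 / 2 * P.omega cov i 0 1 y (X y)| +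
      |((ςB : ℤ) : ℝ) * b y * (P.comp i y (X y) 0 + P.comp i y (X y) 1)| +
      |b y * (P.comp i y (X y) 1 - P.comp i y (X y) 0)|)
    (((continuousAt_const.mul hω).abs.add
      ((continuousAt_const.mul hb').mul (h0.add h1)).abs).add (hb'.mul (h1.sub h0)).abs)
  refine ⟨K, (abs_nonneg _).trans hK.self_of_nhds, ?_⟩
  filter_upwards [hK, (P.isOpen_baseSet i).mem_nhds hx] with y hy hyi
  have hu := norm_le_pi_norm (P.localRep i ε y) 0
  have hw := norm_le_pi_norm (P.localRep i ε y) 1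
  rw [Real.norm_eq_abs] at hu hw
  have hy := (le_abs_self _).trans hy
  have hn := norm_nonneg (P.localRep i ε y)
  have hK0 : 0 ≤ K := le_trans (by positivity) hy
  rw [P.mvfderiv_localRep_eq hcov hε hyi, pi_norm_le_iff_of_nonneg (mul_nonneg hK0 hn)]
  have hmain : ∀ p q r u w : ℝ, |p| + |q| + |r| ≤ K → |u| ≤ ‖P.localRep i ε y‖ →
      |w| ≤ ‖P.localRep i ε y‖ → |p| * |u| + |q| * |w| ≤ K * ‖P.localRep i ε y‖ := by
    intro p q r u w h hu hw
    nlinarith [mul_le_mul_of_nonneg_left hu (abs_nonneg p),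
      mul_le_mul_of_nonneg_left hw (abs_nonneg q), mul_le_mul_of_nonneg_right h hn,
      mul_nonneg (abs_nonneg r) hn]
  intro a
  fin_cases a
  · refine (abs_sub _ _).trans ?_
    rw [abs_mul _ (P.localRep i ε y 0), abs_mul _ (P.localRep i ε y 1)]
    exact hmain _ _ _ _ _ hy hu hw
  · refine (abs_add_le _ _).trans ?_
    rw [abs_mul _ (P.localRep i ε y 1), abs_mul _ (P.localRep i ε y 0), neg_mul, abs_neg]
    exact hmain _ _ _ _ _ ((add_right_comm _ _ _).trans_le hy) hw hu

/-- A Killing spinor which vanishes at a point vanishes near that point. In a chart, the Killing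
equation bounds the differential of its components by a multiple of the components. -/
theorem eventually_localRep_eq_zero (hcov : g.IsLeviCivita cov) {ςB : ℤˣ} {b : M → ℝ}
    (hb : ContMDiff (𝓡 2) 𝓘(ℝ, ℝ) ∞ b)
    {ε : P.SpinorField} (hε : ε ∈ P.killingSpinors cov ςB b) {i : ι} {x : M}
    (hx : x ∈ P.baseSet i) (h0 : P.localRep i ε x = 0) :
    ∀ᶠ y in 𝓝 x, P.localRep i ε y = 0 := by
  set φ := extChartAt (𝓡 2) x with hφ
  set e := trivializationAt Plane (TangentSpace (𝓡 2) : M → Type _) x with he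
  let B := (EuclideanSpace.basisFun (Fin 2) ℝ).toBasis
  have hxe : x ∈ e.baseSet := FiberBundle.mem_baseSet_trivializationAt' x
  have hW : ∀ j, ContMDiffAt (𝓡 2) (𝓡 2).tangent ∞ (fun y ↦ (Bundle.TotalSpace.mk' Plane y
      (e.localFrame B j y) : TangentBundle (𝓡 2) M)) x := fun j ↦
    contMDiffAt_localFrame_of_mem (I := 𝓡 2) ∞ e B j hxe
  choose K hK0 hK using fun j ↦ P.exists_norm_mvfderiv_localRep_le hcov hb hε hx (hW j)
  have hφs : ∀ᶠ y in 𝓝 x, y ∈ (chartAt Plane x).source := chart_source_mem_nhds Plane x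
  -- `D` is the differential of the components at `y`, read in the chart at `x`; the tangent vectors
  -- of the coordinate lines are given by the trivialization `e`.
  have hcomp : ∀ y ∈ (chartAt Plane x).source, y ∈ P.baseSet i →
      ∃ D : Plane →L[ℝ] Pinor, HasFDerivAt (P.localRep i ε ∘ φ.symm) D (φ y) ∧
        ∀ w : Plane, D w = mvfderiv (𝓡 2) (P.localRep i ε) y (e.symmL ℝ y w) := by
    intro y hy hyi
    have hinv : φ.symm (φ y) = y := φ.left_inv (by simpa [hφ] using hy)
    have hsymm : MDifferentiableWithinAt 𝓘(ℝ, Plane) (𝓡 2) φ.symm (Set.range (𝓡 2)) (φ y) :=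
      mdifferentiableWithinAt_extChartAt_symm (φ.map_source (by simpa [hφ] using hy))
    have hloc : ∀ y', y' = y → HasMFDerivAt (𝓡 2) 𝓘(ℝ, Pinor) (P.localRep i ε) y'
        (mvfderiv (𝓡 2) (P.localRep i ε) y : Plane →L[ℝ] Pinor) := by
      rintro _ rfl
      exact (P.mdifferentiableAt_localRep i ε hyi).hasMFDerivAt
    have h := (hloc _ hinv).comp_hasMFDerivWithinAt (φ y) hsymm.hasMFDerivWithinAt
    refine ⟨_, (hasMFDerivWithinAt_iff_hasFDerivWithinAt.1 h).hasFDerivAt (by simp),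
      fun w ↦ ?_⟩
    rw [TangentBundle.symmL_trivializationAt hy]
    rfl
  have hder : ∀ᶠ y in 𝓝 x, ∀ j, fderiv ℝ (P.localRep i ε ∘ φ.symm) (φ y) (B j) =
        mvfderiv (𝓡 2) (P.localRep i ε) y (e.localFrame B j y) := by
    filter_upwards [hφs, (P.isOpen_baseSet i).mem_nhds hx] with y hy hyi j
    have hye : y ∈ e.baseSet := by simpa [he] using hy
    have h1 : e.localFrame B j y = e.symmL ℝ y (B j) := by
      rw [e.localFrame_apply_of_mem_baseSet B hye, e.symmL_apply hye]
      simp [Bundle.Trivialization.basisAt]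
    obtain ⟨D, hD, hD'⟩ := hcomp y hy hyi
    rw [hD.fderiv, h1, hD']
  have hdiff : ∀ᶠ y in 𝓝 x, DifferentiableAt ℝ (P.localRep i ε ∘ φ.symm) (φ y) := by
    filter_upwards [hφs, (P.isOpen_baseSet i).mem_nhds hx] with y hy hyi
    obtain ⟨D, hD, -⟩ := hcomp y hy hyi
    exact hD.differentiableAt
  have hnorm : ∀ᶠ y in 𝓝 x, ‖fderiv ℝ (P.localRep i ε ∘ φ.symm) (φ y)‖ ≤
      (K 0 + K 1) * ‖(P.localRep i ε ∘ φ.symm) (φ y)‖ := by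
    filter_upwards [hK 0, hK 1, hder, hφs] with y h0 h1 hd hy
    have hinv : φ.symm (φ y) = y := φ.left_inv (by simpa [hφ] using hy)
    have hn := norm_nonneg (P.localRep i ε y)
    rw [Function.comp_apply, hinv]
    refine ContinuousLinearMap.opNorm_le_bound _
      (mul_nonneg (add_nonneg (hK0 0) (hK0 1)) hn) fun w ↦ ?_
    rw [← hd] at h0 h1
    conv_lhs => rw [← B.sum_repr w]
    rw [Fin.sum_univ_two, map_add, map_smul, map_smul]
    have hc : ∀ j, ‖B.repr w j‖ ≤ ‖w‖ := fun j ↦ by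
      simpa [B] using PiLp.norm_apply_le w j
    refine (norm_add_le _ _).trans ?_
    rw [norm_smul, norm_smul]
    have := mul_le_mul (hc 0) h0 (norm_nonneg _) (norm_nonneg _)
    have := mul_le_mul (hc 1) h1 (norm_nonneg _) (norm_nonneg _)
    linarith
  have hmap : map φ (𝓝 x) = 𝓝 (φ x) := map_extChartAt_nhds_of_boundaryless x
  have hzero : ∀ᶠ z in 𝓝 (φ x), (P.localRep i ε ∘ φ.symm) z = 0 :=
    eventually_eq_zero_of_norm_fderiv_le (by rw [← hmap]; exact hdiff)
      (by rw [← hmap]; exact hnorm) (by simpa [hφ] using h0)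
  rw [← hmap] at hzero
  filter_upwards [hzero, hφs] with y h hy
  have hinv : φ.symm (φ y) = y := φ.left_inv (by simpa [hφ] using hy)
  change P.localRep i ε (φ.symm (φ y)) = 0 at h
  rwa [hinv] at h

theorem localRep_eq_zero_iff (ε : P.SpinorField) {i : ι} {x : M} (hx : x ∈ P.baseSet i) :
    P.localRep i ε x = 0 ↔ ε x = 0 := by
  have hxi := P.mem_baseSet_at x
  have hrep : ∀ s : Pinor, P.trans (P.indexAt x) i x *ᵥ s = 0 ↔ s = 0 := by
    refine fun s ↦ ⟨fun h ↦ ?_, fun h ↦ by rw [h, Matrix.mulVec_zero]⟩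
    have h1 := congrArg (P.trans i (P.indexAt x) x *ᵥ ·) h
    rwa [Matrix.mulVec_mulVec, P.trans_comp _ _ _ x ⟨⟨hxi, hx⟩, hxi⟩, P.trans_self _ x hxi,
      Matrix.one_mulVec, Matrix.mulVec_zero] at h1
  exact hrep (ε x)

/-- On a connected surface, a Killing spinor is determined by its value at one point. -/
theorem eq_zero_of_localRep_eq_zero [PreconnectedSpace M] (hcov : g.IsLeviCivita cov) {ςB : ℤˣ}
    {b : M → ℝ} (hb : ContMDiff (𝓡 2) 𝓘(ℝ, ℝ) ∞ b)
    {ε : P.SpinorField} (hε : ε ∈ P.killingSpinors cov ςB b) {i : ι} {x : M}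
    (hx : x ∈ P.baseSet i) (h0 : P.localRep i ε x = 0) : ε = 0 := by
  -- The zero set is closed by continuity and open by local unique continuation.
  have hclopen : IsClopen {y | ε y = 0} := by
    constructor
    · rw [← isOpen_compl_iff, isOpen_iff_mem_nhds]
      intro y hy
      have hyi := P.mem_baseSet_at y
      have hne : P.localRep (P.indexAt y) ε y ≠ 0 := fun h ↦
        hy ((P.localRep_eq_zero_iff ε hyi).1 h)
      filter_upwards [(P.contMDiffAt_localRep ε hyi).continuousAt.eventually_ne hne,
        (P.isOpen_baseSet _).mem_nhds hyi] with z hz hzi hz0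
      exact hz ((P.localRep_eq_zero_iff ε hzi).2 hz0)
    · rw [isOpen_iff_mem_nhds]
      intro y hy
      have hyi := P.mem_baseSet_at y
      filter_upwards [P.eventually_localRep_eq_zero hcov hb hε hyi
        ((P.localRep_eq_zero_iff ε hyi).2 hy), (P.isOpen_baseSet _).mem_nhds hyi] with z hz hzi
      exact (P.localRep_eq_zero_iff ε hzi).1 hz
  have huniv := hclopen.eq_univ ⟨x, (P.localRep_eq_zero_iff ε hx).1 h0⟩
  ext y
  exact Set.eq_univ_iff_forall.1 huniv y

/-- If one and the same component of all Killing spinors vanishes at `x`, their values at `x` lie on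
a line, so the Killing spinors form a space of dimension at most one. -/
theorem killingSpinors_eq_span [PreconnectedSpace M] (hcov : g.IsLeviCivita cov) {ςB : ℤˣ}
    {b : M → ℝ} (hb : ContMDiff (𝓡 2) 𝓘(ℝ, ℝ) ∞ b) {i : ι} {x : M} (hx : x ∈ P.baseSet i)
    {a : Fin 2} (ha : ∀ ε ∈ P.killingSpinors cov ςB b, P.localRep i ε x a = 0)
    {ε : P.SpinorField} (hε : ε ∈ P.killingSpinors cov ςB b) (hne : ε ≠ 0) :
    P.killingSpinors cov ςB b = Submodule.span ℝ {ε} := by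
  have hindex : ∀ a : Fin 2, ∃ a', ∀ c, c = a ∨ c = a' := by decide
  obtain ⟨a', ha'⟩ := hindex a
  have hεa' : P.localRep i ε x a' ≠ 0 := by
    intro h
    refine hne (P.eq_zero_of_localRep_eq_zero hcov hb hε hx ?_)
    ext c
    obtain rfl | rfl := ha' c
    exacts [ha ε hε, h]
  refine le_antisymm (fun φ hφ ↦ ?_) ((Submodule.span_singleton_le_iff_mem _ _).2 hε)
  rw [Submodule.mem_span_singleton]
  set c := P.localRep i φ x a' / P.localRep i ε x a' with hc
  -- The constant `c` is chosen so that `c • ε - φ` vanishes at `x`.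
  refine ⟨c, ?_⟩
  rw [← sub_eq_zero, sub_eq_add_neg, ← neg_one_smul ℝ φ]
  refine P.eq_zero_of_localRep_eq_zero hcov hb
    (add_mem (Submodule.smul_mem _ c hε) (Submodule.smul_mem _ (-1 : ℝ) hφ)) hx ?_
  rw [localRep_add, localRep_smul, localRep_smul]
  ext d
  obtain rfl | rfl := ha' d
  · simp [ha ε hε, ha φ hφ]
  · simp [hc, hεa']

end SpinStructure

end KillingSpinor2D

theorem lemma4p4 {M : Type*} [TopologicalSpace M] [T2Space M] [SecondCountableTopology M]
    [ConnectedSpace M] [ChartedSpace KillingSpinor2D.Plane M] [IsManifold (𝓡 2) ∞ M]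
    (g : KillingSpinor2D.LorentzMetric M)
    (cov : CovariantDerivative (𝓡 2) KillingSpinor2D.Plane (TangentSpace (𝓡 2) : M → Type _))
    (hcov : g.IsLeviCivita cov)
    {ι : Type*} (P : KillingSpinor2D.SpinStructure g ι)
    (B : LinearMap.BilinForm ℝ KillingSpinor2D.Pinor) (ςB : ℤˣ)
    (hB : KillingSpinor2D.IsAdmissibleBilinear B ςB)
    (b : M → ℝ) (hb : ContMDiff (𝓡 2) 𝓘(ℝ, ℝ) ∞ b)
    (hK : P.killingSpinors cov ςB b ≠ ⊥) :
    (∀ p : M, ((ςB : ℤ) : ℝ) * g.normSq p (mvfderiv (𝓡 2) b p) ≤ 0) ∧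
    (∀ p : M, g.normSq p (mvfderiv (𝓡 2) b p) = 0 ↔
      (mvfderiv (𝓡 2) b p = 0 ∨
        ∃ ε : P.SpinorField, P.killingSpinors cov ςB b = Submodule.span ℝ {ε} ∧
          P.IsChiralAt ε p)) := by
  obtain ⟨ε, hε, hne⟩ := (Submodule.ne_bot_iff _).1 hK
  have hς : ((ςB : ℤ) : ℝ) ^ 2 = 1 := by
    obtain rfl | rfl := Int.units_eq_one_or ςB <;> simp
  have hvalue : ∀ φ ∈ P.killingSpinors cov ςB b, φ ≠ 0 → ∀ p : M,
      P.localRep (P.indexAt p) φ p 0 ≠ 0 ∨ P.localRep (P.indexAt p) φ p 1 ≠ 0 := by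
    intro φ hφ hφ0 p
    by_contra! h
    refine hφ0 (P.eq_zero_of_localRep_eq_zero hcov hb hφ (P.mem_baseSet_at p) ?_)
    ext a
    fin_cases a
    exacts [h.1, h.2]
  refine ⟨fun p ↦ ?_, fun p ↦ ?_⟩
  · have hx := P.mem_baseSet_at p
    have hcur := P.null_components_db_mul_sq hcov hb hε hx
    rw [P.normSq_eq hx]
    generalize mvfderiv (𝓡 2) b p (P.frame (P.indexAt p) 0 p) = α at *
    generalize mvfderiv (𝓡 2) b p (P.frame (P.indexAt p) 1 p) = β at *
    rcases hvalue ε hε hne p with h | h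
    · refine nonpos_of_mul_nonpos_left (b := P.localRep (P.indexAt p) ε p 0 ^ 2) ?_ (by positivity)
      have : (ςB : ℤ) * (-α ^ 2 + β ^ 2) * P.localRep (P.indexAt p) ε p 0 ^ 2 =
          -((β - α) * P.localRep (P.indexAt p) ε p 1) ^ 2 := by
        linear_combination ((ςB : ℤ) : ℝ) * (β - α) * hcur -
          ((β - α) * P.localRep (P.indexAt p) ε p 1) ^ 2 * hς
      rw [this]
      exact neg_nonpos.2 (sq_nonneg _)
    · refine nonpos_of_mul_nonpos_left (b := P.localRep (P.indexAt p) ε p 1 ^ 2) ?_ (by positivity)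
      have : (ςB : ℤ) * (-α ^ 2 + β ^ 2) * P.localRep (P.indexAt p) ε p 1 ^ 2 =
          -((β + α) * P.localRep (P.indexAt p) ε p 0) ^ 2 := by
        linear_combination (β + α) * hcur
      rw [this]
      exact neg_nonpos.2 (sq_nonneg _)
  · have hx := P.mem_baseSet_at p
    have hzero : mvfderiv (𝓡 2) b p (P.frame (P.indexAt p) 0 p) = 0 →
        mvfderiv (𝓡 2) b p (P.frame (P.indexAt p) 1 p) = 0 → mvfderiv (𝓡 2) b p = 0 := by
      intro h0 h1
      ext v
      rw [← P.sum_comp_smul_frame hx v, Fin.sum_univ_two, map_add, map_smul, map_smul, h0, h1]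
      simp
    have hcur := fun φ (hφ : φ ∈ P.killingSpinors cov ςB b) ↦
      P.null_components_db_mul_sq (ε := φ) hcov hb hφ hx
    rw [P.normSq_eq hx]
    constructor
    · intro h
      by_cases hd : mvfderiv (𝓡 2) b p = 0
      · exact Or.inl hd
      refine Or.inr ⟨ε, ?_⟩
      suffices ∃ a, ∀ φ ∈ P.killingSpinors cov ςB b, P.localRep (P.indexAt p) φ p a = 0 by
        obtain ⟨a, ha⟩ := this
        refine ⟨P.killingSpinors_eq_span hcov hb hx ha hε hne,
          (KillingSpinor2D.isChiral_iff _).2 ?_⟩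
        fin_cases a
        exacts [Or.inl (ha ε hε), Or.inr (ha ε hε)]
      generalize mvfderiv (𝓡 2) b p (P.frame (P.indexAt p) 0 p) = α at *
      generalize mvfderiv (𝓡 2) b p (P.frame (P.indexAt p) 1 p) = β at *
      have hprod : (β - α) * (α + β) = 0 := by linear_combination h
      rcases mul_eq_zero.1 hprod with h' | h'
      · have hne' : α + β ≠ 0 := fun h'' ↦ hd (hzero (by linarith) (by linarith))
        refine ⟨0, fun φ hφ ↦ ?_⟩
        have := hcur φ hφ
        rw [h'] at this
        simpa [hne'] using this
      · have hne' : β - α ≠ 0 := fun h'' ↦ hd (hzero (by linarith) (by linarith))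
        refine ⟨1, fun φ hφ ↦ ?_⟩
        have := hcur φ hφ
        rw [h'] at this
        have hς0 : ((ςB : ℤ) : ℝ) ≠ 0 := fun h ↦ by simp [h] at hς
        have h3 : (((ςB : ℤ) : ℝ) * (β - α)) * P.localRep (P.indexAt p) φ p 1 ^ 2 = 0 := by
          linear_combination this
        exact pow_eq_zero_iff two_ne_zero |>.1
          ((mul_eq_zero.1 h3).resolve_left (mul_ne_zero hς0 hne'))
    · rintro (h | ⟨φ, hspan, hchiral⟩)
      · simp [h]
      have hφ : φ ∈ P.killingSpinors cov ςB b := hspan ▸ Submodule.mem_span_singleton_self φ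
      have hφ0 : φ ≠ 0 := by
        rintro rfl
        exact hK (by simpa using hspan)
      have hc := hcur φ hφ
      have hv := hvalue φ hφ hφ0 p
      have hch : P.localRep (P.indexAt p) φ p 0 = 0 ∨ P.localRep (P.indexAt p) φ p 1 = 0 :=
        (KillingSpinor2D.isChiral_iff _).1 hchiral
      generalize mvfderiv (𝓡 2) b p (P.frame (P.indexAt p) 0 p) = α at *
      generalize mvfderiv (𝓡 2) b p (P.frame (P.indexAt p) 1 p) = β at *
      rcases hch with h | h
      · have hw := hv.resolve_left (not_not.2 h)
        have h3 : (β - α) * P.localRep (P.indexAt p) φ p 1 ^ 2 = 0 := by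
          rw [h] at hc
          linear_combination ((ςB : ℤ) : ℝ) * hc - (β - α) *
            P.localRep (P.indexAt p) φ p 1 ^ 2 * hς
        have := (mul_eq_zero.1 h3).resolve_right (pow_ne_zero 2 hw)
        linear_combination (β + α) * this
      · have hu := hv.resolve_right (not_not.2 h)
        have h3 : (α + β) * P.localRep (P.indexAt p) φ p 0 ^ 2 = 0 := by
          rw [h] at hc
          linear_combination hc
        have := (mul_eq_zero.1 h3).resolve_right (pow_ne_zero 2 hu)
        linear_combination (β - α) * this
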